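/- For $n,k\in\mathbb{N}$, a $k$-partition of $n$ is a partition of the set $\{0,1,\dots,n-1\}$ into exactly $k$ nonempty pieces (blocks); let $(n)^k$ denote the set of all $k$-partitions of $n$. For $t\in(n)^m$, let $(t)^k$ denote the set of all $s\in(n)^k$ that are coarser than $t$, i.e. such that every block of $t$ is a subset of some block of $s$. **Corollary (Ramsey's theorem for $n$-parameter sets; Graham–Rothschild).** For all positive integers $r$, $k$ and $m$ with $k\le m$ there exists $n\in\mathbb{N}$ such that for every coloring $c:(n)^k\to\{0,1,\dots,r-1\}$ there exists $t\in(n)^m$ such that $c$ is constant on $(t)^k$. -/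

import Mathlib

/-- `(n)^k`: the partitions of `n = {0, …, n - 1}` into exactly `k` (nonempty) pieces. -/
abbrev KPartition (n k : ℕ) : Type :=
  {P : Finpartition (Finset.range n) // P.parts.card = k}

/-- `(t)^k`: the `k`-partitions `s` of `n` that are coarser than `t`, i.e. every block of `t`
is a subset of some block of `s`. -/
def KPartition.coarsenings {n m : ℕ} (t : KPartition n m) (k : ℕ) : Set (KPartition n k) :=
  {s | ∀ b ∈ t.1.parts, ∃ a ∈ s.1.parts, b ⊆ a}

/-!
A partition of `{0, …, n - 1}` into `k` blocks, numbered by their least elements, is a surjection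
onto `{0, …, k - 1}` taking new values in increasing order (a rigid surjection), and the partitions
coarser than that of `t` are those of the compositions `f ∘ t`. A rigid surjection that is the
identity on `{0, …, a - 1}` is a word over the alphabet `{0, …, a - 1}` with parameters, and
composition is substitution into words. The theorem for words with `d` parameters is proved by
induction on `d`; words without parameters are the multidimensional Hales–Jewett theorem.

A word with `d + 1` parameters whose first parameter is at the place `q` becomes a word with `d`
parameters if the places up to `q` are declared to be letters. The theorem for `d` parameters and
each of the alphabets `{0, …, q}` in turn makes the colour of a word depend only on its part up to
the first parameter. The Hales–Jewett theorem, applied once for each place, makes it depend only on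
the place of the first parameter. The pigeonhole principle then gives a set of places of equal
colour, large enough to carry all the parameters of the word that is sought.
-/

open Function

/-- `f` takes a value `≥ j` for the first time at `i`, and `f i = j`. If `f` takes new values in
increasing order, this says that `i` is the first occurrence of `j`. -/
def FirstAt (f : ℕ → ℕ) (i j : ℕ) : Prop :=
  f i = j ∧ ∀ i' < i, f i' < j

/-- Rigid surjections from `{0, …, n - 1}` onto `{0, …, k - 1}`: the functions that take new values
in increasing order and are the identity on `{0, …, a - 1}`. They are viewed as words of length
`n - a` over the alphabet `{0, …, a - 1}` in which the parameters `a, …, k - 1` all occur. They are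
encoded as functions on `ℕ` that vanish outside of their domain. -/
structure IsRigid (a n k : ℕ) (f : ℕ → ℕ) : Prop where
  le : a ≤ k
  fix : ∀ i < a, f i = i
  lt : ∀ i < n, f i < k
  zero : ∀ i, n ≤ i → f i = 0
  first : ∀ j < k, ∃ i < n, FirstAt f i j

/-- The part of `f` up to and including the first occurrence of `a`, extended by `0`. -/
noncomputable def head (a : ℕ) (f : ℕ → ℕ) : ℕ → ℕ :=
  {i | ∀ i' < i, f i' ≠ a}.indicator f

namespace FirstAt

variable {f g t : ℕ → ℕ} {i i' j p q : ℕ}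

theorem eq_of_firstAt (h : FirstAt f i j) (h' : FirstAt f i' j) : i = i' := by
  rcases lt_trichotomy i i' with hlt | rfl | hlt
  · exact absurd h.1 (h'.2 i hlt).ne
  · rfl
  · exact absurd h'.1 (h.2 i' hlt).ne

theorem comp (hf : FirstAt f q j) (ht : FirstAt t i q) : FirstAt (f ∘ t) i j :=
  ⟨by rw [comp_apply, ht.1, hf.1], fun i' hi' => hf.2 _ (ht.2 i' hi')⟩

theorem congr (hf : FirstAt f i j) (h : Set.EqOn f g (Set.Iic i)) : FirstAt g i j :=
  ⟨h (Set.mem_Iic.2 le_rfl) ▸ hf.1, fun i' hi' => h (Set.mem_Iic.2 hi'.le) ▸ hf.2 i' hi'⟩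

theorem head_eq (h : FirstAt f i j) : head j f = (Set.Iic i).indicator f := by
  refine congrArg (Set.indicator · f) (Set.ext fun x => ⟨fun hx => ?_, fun hx i' hi' => ?_⟩)
  · exact not_lt.1 fun hlt => hx i hlt h.1
  · exact (h.2 i' (hi'.trans_le hx)).ne

theorem eqOn_head (h : FirstAt f i j) : Set.EqOn f (head j f) (Set.Iic i) := by
  rw [h.head_eq]
  exact Set.eqOn_indicator.symm

theorem head_congr (h : FirstAt f i j) (hfg : Set.EqOn f g (Set.Iic i)) : head j f = head j g := by
  rw [h.head_eq, (h.congr hfg).head_eq]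
  exact Set.indicator_congr fun _ hx => hfg hx

theorem eq_of_head_eq (hf : FirstAt f p j) (hg : FirstAt g q j) (h : head j f = head j g) :
    p = q :=
  (hf.congr hf.eqOn_head).eq_of_firstAt (h ▸ hg.congr hg.eqOn_head)

theorem eqOn_of_head_eq (hf : FirstAt f p j) (hg : FirstAt g p j) (h : head j f = head j g) :
    Set.EqOn f g (Set.Iic p) :=
  hf.eqOn_head.trans (h ▸ hg.eqOn_head.symm)

theorem head_head_comp (hf : FirstAt f q j) (ht : FirstAt t i q) :
    head j (head j f ∘ t) = head j (f ∘ t) := by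
  refine ((hf.comp ht).head_congr fun i' hi' => hf.eqOn_head ?_).symm
  rcases (Set.mem_Iic.1 hi').lt_or_eq with hlt | rfl
  · exact (ht.2 i' hlt).le
  · exact ht.1.le

end FirstAt

namespace IsRigid

variable {a b n m k q : ℕ} {f g t : ℕ → ℕ}

theorem firstAt_self {i : ℕ} (hf : IsRigid a n k f) (hi : i < a) : FirstAt f i i :=
  ⟨hf.fix i hi, fun i' hi' => by rwa [hf.fix i' (hi'.trans hi)]⟩

theorem le_of_firstAt (hf : IsRigid a n k f) (h : FirstAt f q a) : a ≤ q :=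
  not_lt.1 fun hq => hq.ne ((hf.fix q hq).symm.trans h.1)

theorem image_range (hf : IsRigid a n k f) :
    (Finset.range n).image f = Finset.range k := by
  ext j
  simp only [Finset.mem_image, Finset.mem_range]
  constructor
  · rintro ⟨i, hi, rfl⟩
    exact hf.lt i hi
  · intro hj
    obtain ⟨i, hi, h⟩ := hf.first j hj
    exact ⟨i, hi, h.1⟩

theorem le_length (hf : IsRigid a n k f) : k ≤ n := by
  simpa [hf.image_range] using Finset.card_image_le (s := Finset.range n) (f := f)

theorem lt_length (hf : IsRigid a n k f) {i j : ℕ} (hj : j < k) (h : FirstAt f i j) : i < n := by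
  obtain ⟨i', hi', h'⟩ := hf.first j hj
  exact h.eq_of_firstAt h' ▸ hi'

theorem map_zero (hf : IsRigid a n k f) : f 0 = 0 := by
  rcases n.eq_zero_or_pos with rfl | hn
  · exact hf.zero 0 le_rfl
  · obtain ⟨i, -, h0, hlt⟩ := hf.first 0 ((Nat.zero_le _).trans_lt (hf.lt 0 hn))
    rcases i.eq_zero_or_pos with rfl | hi
    · exact h0
    · exact absurd (hlt 0 hi) (Nat.not_lt_zero _)

theorem comp (hf : IsRigid a m k f) (ht : IsRigid a n m t) : IsRigid a n k (f ∘ t) where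
  le := hf.le
  fix i hi := by rw [comp_apply, ht.fix i hi, hf.fix i hi]
  lt i hi := hf.lt _ (ht.lt i hi)
  zero i hi := by rw [comp_apply, ht.zero i hi, hf.map_zero]
  first j hj := by
    obtain ⟨q, hq, hfq⟩ := hf.first j hj
    obtain ⟨i, hi, hti⟩ := ht.first q hq
    exact ⟨i, hi, hfq.comp hti⟩

theorem mono (hba : b ≤ a) (hf : IsRigid a n k f) : IsRigid b n k f :=
  ⟨hba.trans hf.le, fun i hi => hf.fix i (hi.trans_le hba), hf.lt, hf.zero, hf.first⟩

theorem of_forall_ge (hak : a ≤ k) (han : a ≤ n) (hfix : ∀ i < a, f i = i)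
    (hlt : ∀ i < n, f i < k) (hzero : ∀ i, n ≤ i → f i = 0)
    (hfirst : ∀ j, a ≤ j → j < k → ∃ i < n, FirstAt f i j) : IsRigid a n k f where
  le := hak
  fix := hfix
  lt := hlt
  zero := hzero
  first j hj := by
    rcases lt_or_ge j a with hja | hja
    · exact ⟨j, hja.trans_le han, hfix j hja, fun i hi => by rwa [hfix i (hi.trans hja)]⟩
    · exact hfirst j hja hj

theorem indicator_Iio (haq : a ≤ q) (hfix : ∀ i < a, f i = i) (hlt : ∀ i < q, f i < a) :
    IsRigid a q a ((Set.Iio q).indicator f) := by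
  have hf : ∀ i < q, (Set.Iio q).indicator f i = f i := fun i hi =>
    Set.indicator_of_mem (Set.mem_Iio.2 hi) f
  refine of_forall_ge le_rfl haq (fun i hi => ?_) (fun i hi => ?_) (fun i hi => ?_)
    fun j hj hj' => absurd hj (not_le.2 hj')
  · rw [hf i (hi.trans_le haq), hfix i hi]
  · exact hf i hi ▸ hlt i hi
  · exact Set.indicator_of_notMem (Set.notMem_Iio.2 hi) f

theorem indicator_Iio_id (han : a ≤ n) : IsRigid a n n ((Set.Iio n).indicator id) :=
  (indicator_Iio le_rfl (fun _ _ => rfl) fun _ hi => hi).mono han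

theorem update_of_lt (hf : IsRigid a n k f) {j : ℕ} (hj : j < k) :
    IsRigid a (n + 1) k (update f n j) where
  le := hf.le
  fix i hi := by
    rw [update_of_ne (by have := hf.le; have := hf.le_length; omega), hf.fix i hi]
  lt i hi := by
    rcases (Nat.le_of_lt_succ hi).lt_or_eq with h | rfl
    · rw [update_of_ne h.ne]
      exact hf.lt i h
    · rwa [update_self]
  zero i hi := by rw [update_of_ne (by omega), hf.zero i (by omega)]
  first j' hj' := by
    obtain ⟨i, hi, h⟩ := hf.first j' hj'
    refine ⟨i, hi.trans n.lt_succ_self, h.congr fun x hx => (update_of_ne ?_ _ _).symm⟩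
    exact ((Set.mem_Iic.1 hx).trans_lt hi).ne

theorem update_self (hf : IsRigid a n k f) : IsRigid a (n + 1) (k + 1) (update f n k) where
  le := hf.le.trans k.le_succ
  fix i hi := by
    rw [update_of_ne (by have := hf.le; have := hf.le_length; omega), hf.fix i hi]
  lt i hi := by
    rcases (Nat.le_of_lt_succ hi).lt_or_eq with h | rfl
    · rw [update_of_ne h.ne]
      exact (hf.lt i h).trans k.lt_succ_self
    · rw [Function.update_self]
      exact k.lt_succ_self
  zero i hi := by rw [update_of_ne (by omega), hf.zero i (by omega)]
  first j hj := by
    rcases (Nat.le_of_lt_succ hj).lt_or_eq with h | rfl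
    · obtain ⟨i, hi, h⟩ := hf.first j h
      refine ⟨i, hi.trans n.lt_succ_self, h.congr fun x hx => (update_of_ne ?_ _ _).symm⟩
      exact ((Set.mem_Iic.1 hx).trans_lt hi).ne
    · refine ⟨n, n.lt_succ_self, Function.update_self .., fun i hi => ?_⟩
      rw [update_of_ne hi.ne]
      exact hf.lt i hi

theorem ext_of_lt (hf : IsRigid a n k f) (hg : IsRigid a n k g) (h : ∀ i < n, f i = g i) :
    f = g := by
  funext i
  rcases lt_or_ge i n with hi | hi
  · exact h i hi
  · rw [hf.zero i hi, hg.zero i hi]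

instance finite (a n k : ℕ) : Finite {f // IsRigid a n k f} := by
  refine Finite.of_injective
    (fun (f : {f // IsRigid a n k f}) (i : Fin n) => (⟨f.1 i, f.2.lt i i.2⟩ : Fin k)) ?_
  intro f g h
  exact Subtype.ext (f.2.ext_of_lt g.2 fun i hi => congrArg Fin.val (congrFun h ⟨i, hi⟩))

theorem exists_comp_eq (hg : IsRigid a n k g) (ht : IsRigid a n m t)
    (h : ∀ i < n, ∀ i' < n, t i = t i' → g i = g i') : ∃ f, IsRigid a m k f ∧ f ∘ t = g := by
  choose! φ hφn hφ using ht.first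
  have hgφ : ∀ i < n, g (φ (t i)) = g i := fun i hi =>
    h _ (hφn _ (ht.lt i hi)) _ hi (hφ _ (ht.lt i hi)).1
  have hf : ∀ j < m, (Set.Iio m).indicator (g ∘ φ) j = g (φ j) := fun j hj =>
    Set.indicator_of_mem (Set.mem_Iio.2 hj) _
  have hfix : ∀ j < a, (Set.Iio m).indicator (g ∘ φ) j = j := fun j hj => by
    have hjm := hj.trans_le ht.le
    rw [hf j hjm, (hφ j hjm).eq_of_firstAt (ht.firstAt_self hj), hg.fix j hj]
  have hrigid : IsRigid a m k ((Set.Iio m).indicator (g ∘ φ)) := by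
    refine ⟨hg.le, hfix, fun j hj => hf j hj ▸ hg.lt _ (hφn j hj),
      fun j hj => Set.indicator_of_notMem (Set.notMem_Iio.2 hj) _, fun j hj => ?_⟩
    obtain ⟨i, hi, hij, hlt⟩ := hg.first j hj
    refine ⟨t i, ht.lt i hi, by rw [hf _ (ht.lt i hi), hgφ i hi, hij], fun q hq => ?_⟩
    have hqm := hq.trans (ht.lt i hi)
    rw [hf q hqm]
    refine hlt _ (not_le.1 fun hle => ?_)
    rcases hle.lt_or_eq with hlt | rfl
    · exact hq.not_gt ((hφ q hqm).2 i hlt)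
    · exact hq.ne (hφ q hqm).1.symm
  refine ⟨_, hrigid, funext fun i => ?_⟩
  rcases lt_or_ge i n with hi | hi
  · rw [comp_apply, hf _ (ht.lt i hi), hgφ i hi]
  · rw [comp_apply, ht.zero i hi, hrigid.map_zero, hg.zero i hi]

end IsRigid

theorem exists_isRigid_eq_iff {α : Type*} [DecidableEq α] {a n : ℕ} (s : ℕ → α) (han : a ≤ n)
    (hs : Set.InjOn s (Set.Iio a)) :
    ∃ t, IsRigid a n ((Finset.range n).image s).card t ∧
      ∀ i < n, ∀ j < n, t i = t j ↔ s i = s j := by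
  -- Number the values of `s` in the order of their first occurrences.
  induction n, han using Nat.le_induction with
  | base =>
    rw [Finset.card_image_of_injOn (by simpa using hs), Finset.card_range]
    refine ⟨_, .indicator_Iio_id le_rfl, fun i hi j hj => ?_⟩
    rw [Set.indicator_of_mem (Set.mem_Iio.2 hi), Set.indicator_of_mem (Set.mem_Iio.2 hj),
      hs.eq_iff hi hj, id, id]
  | succ n han ih =>
    obtain ⟨t, ht, hts⟩ := ih
    rw [Finset.range_add_one, Finset.image_insert]
    suffices h : ∃ j, IsRigid a (n + 1) (insert (s n) ((Finset.range n).image s)).card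
        (update t n j) ∧ ∀ i < n, t i = j ↔ s i = s n by
      obtain ⟨j, hrigid, hj⟩ := h
      refine ⟨_, hrigid, fun i hi i' hi' => ?_⟩
      rcases (Nat.le_of_lt_succ hi).lt_or_eq with hi | rfl <;>
        rcases (Nat.le_of_lt_succ hi').lt_or_eq with hi' | rfl
      · rw [update_of_ne hi.ne, update_of_ne hi'.ne, hts i hi i' hi']
      · rw [update_of_ne hi.ne, update_self, hj i hi]
      · rw [update_of_ne hi'.ne, update_self, eq_comm, hj i' hi', eq_comm]
      · simp only
    by_cases hn : s n ∈ (Finset.range n).image s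
    · rw [Finset.insert_eq_of_mem hn]
      obtain ⟨i₀, hi₀, hsi₀⟩ := Finset.mem_image.1 hn
      rw [Finset.mem_range] at hi₀
      exact ⟨t i₀, ht.update_of_lt (ht.lt i₀ hi₀), fun i hi => by rw [hts i hi i₀ hi₀, hsi₀]⟩
    · rw [Finset.card_insert_of_notMem hn]
      refine ⟨_, ht.update_self, fun i hi => iff_of_false (ht.lt i hi).ne fun h => hn ?_⟩
      exact Finset.mem_image.2 ⟨i, Finset.mem_range.2 hi, h⟩

/-- The word `y` as a function on `ℕ`: the identity on `{0, …, a - 1}`, followed by the letters of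
`y` and extended by `0`. -/
def word (a : ℕ) {N : ℕ} (y : Fin N → ℕ) (i : ℕ) : ℕ :=
  if i < a then i else if h : i - a < N then y ⟨i - a, h⟩ else 0

theorem IsRigid.eq_word {a N k : ℕ} {f : ℕ → ℕ} (hf : IsRigid a (a + N) k f) :
    f = word a fun i : Fin N => f (a + i) := by
  funext i
  unfold word
  split_ifs with hi hiN
  · exact hf.fix i hi
  · exact congrArg f (Nat.add_sub_cancel' (not_lt.1 hi)).symm
  · exact hf.zero i (by omega)

theorem word_of_lt {a N i : ℕ} (y : Fin N → ℕ) (hi : i < a) : word a y i = i := if_pos hi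

theorem word_add {a N : ℕ} (y : Fin N → ℕ) (i : Fin N) : word a y (a + i) = y i := by
  simp [word]

theorem image_word {a b N : ℕ} {y : Fin N → ℕ} (hlt : ∀ i, y i < a + b)
    (hsurj : ∀ e < b, ∃ i, y i = a + e) :
    (Finset.range (a + N)).image (word a y) = Finset.range (a + b) := by
  ext j
  simp only [Finset.mem_image, Finset.mem_range]
  constructor
  · rintro ⟨i, hi, rfl⟩
    rcases lt_or_ge i a with hia | hia
    · rw [word_of_lt y hia]
      omega
    · obtain ⟨e, rfl⟩ := Nat.exists_eq_add_of_le hia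
      exact (word_add y ⟨e, by omega⟩).trans_lt (hlt _)
  · intro hj
    rcases lt_or_ge j a with hja | hja
    · exact ⟨j, by omega, word_of_lt y hja⟩
    · obtain ⟨e, rfl⟩ := Nat.exists_eq_add_of_le hja
      obtain ⟨i, hi⟩ := hsurj e (by omega)
      exact ⟨a + i, by omega, (word_add y i).trans hi⟩

theorem exists_isRigid_forall_comp_eq (κ : Type*) [Finite κ] {a m : ℕ} (ham : a ≤ m) :
    ∃ n, ∀ c : (ℕ → ℕ) → κ, ∃ t, IsRigid a n m t ∧
      ∃ x, ∀ f, IsRigid a m a f → c (f ∘ t) = x := by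
  obtain ⟨b, rfl⟩ := Nat.exists_eq_add_of_le ham
  obtain ⟨N, hN⟩ :=
    Combinatorics.Subspace.exists_mono_in_high_dimension_fin (Fin a) κ (Fin b)
  refine ⟨a + N, fun c => ?_⟩
  obtain ⟨l, x, hl⟩ := hN fun y => c (word a fun i => y i)
  choose p hp using l.proper
  let y : Fin N → ℕ := fun i => (l.idxFun i).elim (fun z : Fin a => (z : ℕ)) fun e : Fin b => a + e
  have hy : (Finset.range (a + N)).image (word a y) = Finset.range (a + b) := by
    refine image_word (fun i => ?_) fun e he => ⟨p ⟨e, he⟩, by simp [y, hp]⟩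
    rcases h : l.idxFun i with z | e <;> simp only [y, h, Sum.elim_inl, Sum.elim_inr] <;> omega
  have hinj : Set.InjOn (word a y) (Set.Iio a) := fun i hi j hj h => by
    rwa [word_of_lt y hi, word_of_lt y hj] at h
  -- The parameters of `l` need not occur first in increasing order, so `t` renumbers them.
  obtain ⟨t, ht, hty⟩ := exists_isRigid_eq_iff (word a y) (Nat.le_add_right a N) hinj
  rw [hy, Finset.card_range] at ht
  refine ⟨t, ht, x, fun f hf => ?_⟩
  have hft := hf.comp ht
  refine (congrArg c ?_).trans (hl fun e => ⟨f (t (a + p e)), hft.lt _ (by omega)⟩)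
  refine hft.eq_word.trans (congrArg (word a) (funext fun i => ?_))
  rw [Combinatorics.Subspace.coe_apply]
  rcases h : l.idxFun i with z | e
  · have hz : t (a + i) = t z := (hty _ (by omega) _ (by omega)).2 <| by
      rw [word_add, word_of_lt y z.2]
      simp [y, h]
    simp only [comp_apply, hz, Sum.elim_inl, id]
    exact hft.fix z z.2
  · have he : t (a + i) = t (a + p e) := (hty _ (by omega) _ (by omega)).2 <| by
      simp [word_add, y, h, hp]
    simp only [comp_apply, he, Sum.elim_inr]

/-- The letters from `q` on become the parameters from `a` on, and the smaller letters are replaced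
by those of `w`. This undoes `expand`. -/
def collapse (a q : ℕ) (w : ℕ → ℕ) (i : ℕ) : ℕ :=
  if i < q then w i else i - q + a

/-- The word `f`, whose first parameter `a` is at the place `q`, with the places up to `q` turned
into letters of the alphabet `{0, …, q}`. -/
def expand (a q : ℕ) (f : ℕ → ℕ) (i : ℕ) : ℕ :=
  if i ≤ q then i else if f i < a then f i else f i - a + q

section Expand

variable {a d k n q : ℕ} {f : ℕ → ℕ}

theorem isRigid_expand (hf : IsRigid a n (a + (d + 1)) f) (hq : FirstAt f q a) :
    IsRigid (q + 1) n (q + 1 + d) (expand a q f) := by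
  have haq := hf.le_of_firstAt hq
  have hqn := hf.lt_length (by omega) hq
  refine .of_forall_ge (Nat.le_add_right ..) hqn (fun i hi => if_pos (Nat.le_of_lt_succ hi))
    (fun i hi => ?_) (fun i hi => ?_) fun j hqj hj => ?_
  · have := hf.lt i hi
    unfold expand
    split_ifs <;> omega
  · have := hf.zero i hi
    have := hq.2 0
    have := hf.map_zero
    unfold expand
    split_ifs <;> omega
  · obtain ⟨i, hi, hij, hbefore⟩ := hf.first (j - q + a) (by omega)
    have hqi : q < i := by
      by_contra! h
      rcases h.lt_or_eq with h | rfl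
      · have := hq.2 i h
        omega
      · have := hq.1
        omega
    refine ⟨i, hi, ?_, fun i' hi' => ?_⟩
    · rw [expand, if_neg (by omega), if_neg (by omega)]
      omega
    · have := hbefore i' hi'
      unfold expand
      split_ifs <;> omega

theorem collapse_comp_expand (hf : IsRigid a n k f) (hq : FirstAt f q a) :
    collapse a q ((Set.Iio q).indicator f) ∘ expand a q f = f := by
  funext i
  simp only [comp_apply, collapse, expand, Set.indicator_apply, Set.mem_Iio]
  rcases lt_trichotomy i q with h | rfl | h
  · simp [h, h.le]
  · simp [hq.1]
  · rw [if_neg h.not_ge]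
    by_cases hfa : f i < a
    · simp [hfa, hfa.trans_le (hf.le_of_firstAt hq), hf.fix _ hfa]
    · rw [if_neg hfa, if_neg (by omega)]
      omega

end Expand

/-- The Graham–Rothschild theorem for words with `d` parameters: every colouring of these words
becomes constant after substituting all of them into a suitable word `t` with `m - a` parameters. -/
def GrahamRothschild.{u} (d : ℕ) : Prop :=
  ∀ (a m : ℕ), 0 < a → a ≤ m → ∀ (κ : Type u) [Finite κ] [Nonempty κ], ∃ n,
    ∀ c : (ℕ → ℕ) → κ, ∃ t, IsRigid a n m t ∧ ∃ x, ∀ f, IsRigid a m (a + d) f → c (f ∘ t) = x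

namespace GrahamRothschild

universe u

variable {d : ℕ}

theorem exists_comp_eq_of_firstAt (hd : GrahamRothschild.{u} d) (κ : Type u) [Finite κ]
    [Nonempty κ] {a q M : ℕ} (haq : a ≤ q) (hqM : q < M) :
    ∃ n, ∀ c : (ℕ → ℕ) → κ, ∃ t, IsRigid (q + 1) n M t ∧ ∀ f f',
      IsRigid a M (a + (d + 1)) f → IsRigid a M (a + (d + 1)) f' →
      FirstAt f q a → FirstAt f' q a → head a f = head a f' → c (f ∘ t) = c (f' ∘ t) := by
  obtain ⟨n, hn⟩ := hd (q + 1) M q.succ_pos hqM ({w // IsRigid a q a w} → κ)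
  refine ⟨n, fun c => ?_⟩
  obtain ⟨t, ht, x, hx⟩ := hn fun g w => c (collapse a q w.1 ∘ g)
  refine ⟨t, ht, fun f f' hf hf' hfq hfq' heq => ?_⟩
  have hcolour : ∀ h, IsRigid a M (a + (d + 1)) h → FirstAt h q a →
      ∀ w : {w // IsRigid a q a w}, (Set.Iio q).indicator h = w → c (h ∘ t) = x w := by
    intro h hh hhq w hw
    calc c (h ∘ t) = c (collapse a q w.1 ∘ expand a q h ∘ t) := by
          rw [← hw, ← comp_assoc, collapse_comp_expand hh hhq]
      _ = x w := congrFun (hx _ (isRigid_expand hh hhq)) w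
  have hw := IsRigid.indicator_Iio haq hf.fix hfq.2
  rw [hcolour f hf hfq ⟨_, hw⟩ rfl, hcolour f' hf' hfq' ⟨_, hw⟩ ?_]
  exact Set.indicator_congr fun i hi =>
    (hfq.eqOn_of_head_eq hfq' heq (Set.Iio_subset_Iic_self hi)).symm

theorem exists_comp_eq_of_firstAt_lt (hd : GrahamRothschild.{u} d) (κ : Type u) [Finite κ]
    [Nonempty κ] {a q M : ℕ} (haq : a ≤ q) (hqM : q ≤ M) :
    ∃ n, ∀ c : (ℕ → ℕ) → κ, ∃ t, IsRigid a n M t ∧ ∀ p < q, ∀ f f',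
      IsRigid a M (a + (d + 1)) f → IsRigid a M (a + (d + 1)) f' →
      FirstAt f p a → FirstAt f' p a → head a f = head a f' → c (f ∘ t) = c (f' ∘ t) := by
  induction q, haq using Nat.le_induction generalizing M with
  | base =>
    exact ⟨M, fun c => ⟨_, .indicator_Iio_id hqM, fun p hp f f' hf _ hfp =>
      absurd (hf.le_of_firstAt hfp) (not_le.2 hp)⟩⟩
  | succ q haq ih =>
    obtain ⟨n', hn'⟩ := hd.exists_comp_eq_of_firstAt κ haq hqM
    obtain ⟨t₀, ht₀, -⟩ := hn' fun _ => Classical.arbitrary κ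
    obtain ⟨n, hn⟩ := ih (M := n') ((Nat.le_of_succ_le hqM).trans ht₀.le_length)
    refine ⟨n, fun c => ?_⟩
    obtain ⟨t, ht, htc⟩ := hn c
    obtain ⟨t', ht', htc'⟩ := hn' fun g => c (g ∘ t)
    have ht'a : IsRigid a n' M t' := ht'.mono (haq.trans q.le_succ)
    refine ⟨t' ∘ t, ht'a.comp ht, fun p hp f f' hf hf' hfp hfp' heq => ?_⟩
    rcases (Nat.le_of_lt_succ hp).lt_or_eq with hpq | rfl
    · have hpt' : FirstAt t' p p := ht'.firstAt_self hp
      refine htc p hpq (f ∘ t') (f' ∘ t') (hf.comp ht'a) (hf'.comp ht'a) (hfp.comp hpt')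
        (hfp'.comp hpt') ?_
      rw [← hfp.head_head_comp hpt', heq, hfp'.head_head_comp hpt']
    · exact htc' f f' hf hf' hfp hfp' heq

theorem exists_comp_eq_head (hd : GrahamRothschild.{u} d) (κ : Type u) [Finite κ] [Nonempty κ]
    {a M : ℕ} (haM : a ≤ M) :
    ∃ n, ∀ c : (ℕ → ℕ) → κ, ∃ t, IsRigid a n M t ∧ ∃ D : (ℕ → ℕ) → κ, ∀ f,
      IsRigid a M (a + (d + 1)) f → c (f ∘ t) = D (head a f) := by
  obtain ⟨n, hn⟩ := hd.exists_comp_eq_of_firstAt_lt κ haM le_rfl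
  refine ⟨n, fun c => ?_⟩
  obtain ⟨t, ht, htc⟩ := hn c
  let F : {f // IsRigid a M (a + (d + 1)) f} → κ := fun f => c (f.1 ∘ t)
  have hF : F.FactorsThrough fun f => head a f.1 := fun f f' h => by
    obtain ⟨p, hp, hfp⟩ := f.2.first a (by omega)
    obtain ⟨p', -, hfp'⟩ := f'.2.first a (by omega)
    obtain rfl := hfp.eq_of_head_eq hfp' h
    exact htc p hp f f' f.2 f'.2 hfp hfp' h
  obtain ⟨D, hD⟩ := (factorsThrough_iff F).1 hF
  exact ⟨t, ht, D, fun f hf => congrFun hD ⟨f, hf⟩⟩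

end GrahamRothschild

theorem head_update {a N : ℕ} {f g : ℕ → ℕ} (hlt : ∀ i < N, f i < a) (hgf : ∀ i < N, g i = f i)
    (hzero : ∀ i, N ≤ i → g i = 0) : head a (update f N a) = update g N a := by
  have hN : FirstAt (update f N a) N a :=
    ⟨update_self .., fun i hi => by simpa only [update_of_ne hi.ne] using hlt i hi⟩
  rw [hN.head_eq]
  funext i
  rcases lt_trichotomy i N with hi | rfl | hi
  · rw [Set.indicator_of_mem (Set.mem_Iic.2 hi.le), update_of_ne hi.ne, update_of_ne hi.ne,
      hgf i hi]
  · rw [Set.indicator_of_mem (Set.mem_Iic.2 le_rfl), update_self, update_self]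
  · rw [Set.indicator_of_notMem (Set.notMem_Iic.2 hi), update_of_ne hi.ne', hzero i hi.le]

theorem exists_isRigid_forall_head_comp_eq (κ : Type*) [Finite κ] [Nonempty κ] {a L : ℕ}
    (haL : a ≤ L) :
    ∃ M, ∀ c : (ℕ → ℕ) → κ, ∃ u, IsRigid a M L u ∧ ∃ e : ℕ → κ, ∀ f p, (∀ i < a, f i = i) →
      FirstAt f p a → p < L → c (head a (f ∘ u)) = e p := by
  induction L, haL using Nat.le_induction with
  | base =>
    refine ⟨a, fun c => ⟨_, .indicator_Iio_id le_rfl, fun _ => Classical.arbitrary κ,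
      fun f p hfix hfp hp => absurd ((hfix p hp).symm.trans hfp.1) hp.ne⟩⟩
  | succ L haL ih =>
    obtain ⟨M, hM⟩ := ih
    obtain ⟨u₀, hu₀, -⟩ := hM fun _ => Classical.arbitrary κ
    obtain ⟨N, hN⟩ := exists_isRigid_forall_comp_eq κ (haL.trans hu₀.le_length)
    refine ⟨N + 1, fun c => ?_⟩
    obtain ⟨t, ht, x, hx⟩ := hN fun g => c (update g N a)
    obtain ⟨u, hu, e, he⟩ := hM fun g => c (head a (g ∘ t))
    have hut := hu.comp ht
    refine ⟨_, hut.update_self, update e L x, fun f p hfix hfp hp => ?_⟩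
    rw [comp_update]
    rcases (Nat.le_of_lt_succ hp).lt_or_eq with hpL | rfl
    · obtain ⟨j, hj, hju⟩ := hu.first p hpL
      obtain ⟨i, hi, hit⟩ := ht.first j hj
      have hfu : FirstAt (f ∘ u) j a := hfp.comp hju
      have heq : Set.EqOn ((f ∘ u) ∘ t) (update (f ∘ u ∘ t) N (f L)) (Set.Iic i) := fun i' hi' =>
        (update_of_ne ((Set.mem_Iic.1 hi').trans_lt hi).ne _ _).symm
      rw [update_of_ne hpL.ne, ← he f p hfix hfp hpL, ← (hfu.comp hit).head_congr heq,
        hfu.head_head_comp hit]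
    · have hw := IsRigid.indicator_Iio haL hfix hfp.2
      have hword : ∀ i < N, ((Set.Iio p).indicator f ∘ u ∘ t) i = (f ∘ u ∘ t) i := fun i hi =>
        Set.indicator_of_mem (Set.mem_Iio.2 (hut.lt i hi)) f
      rw [update_self, hfp.1, head_update (f := f ∘ u ∘ t)
        (fun i hi => hfp.2 _ (hut.lt i hi)) hword (hw.comp hut).zero]
      exact hx _ (hw.comp hu)

theorem exists_isRigid_firstAt_mem {a L : ℕ} (ha : 0 < a) (haL : a ≤ L) {S : Finset ℕ}
    (hS : S ⊆ Finset.Ico a L) :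
    ∃ v, IsRigid a L (a + S.card) v ∧ ∀ q i, a ≤ q → FirstAt v i q → i ∈ S := by
  let s : ℕ → ℕ := fun i => if i < a ∨ i ∈ S then i else 0
  have hs : (Finset.range L).image s = Finset.range a ∪ S := by
    ext i
    simp only [Finset.mem_image, Finset.mem_union, Finset.mem_range]
    constructor
    · rintro ⟨j, -, rfl⟩
      simp only [s]
      split_ifs with h
      exacts [h, .inl ha]
    · intro h
      refine ⟨i, ?_, if_pos h⟩
      exact h.elim (·.trans_le haL) fun hi => (Finset.mem_Ico.1 (hS hi)).2
  have hdisj : Disjoint (Finset.range a) S := Finset.disjoint_left.2 fun i hi hiS =>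
    (Finset.mem_range.1 hi).not_ge (Finset.mem_Ico.1 (hS hiS)).1
  have hinj : Set.InjOn s (Set.Iio a) := fun i hi j hj h => by
    simpa only [s, Set.mem_Iio.1 hi, Set.mem_Iio.1 hj, true_or, if_true] using h
  obtain ⟨v, hv, hvs⟩ := exists_isRigid_eq_iff s haL hinj
  rw [hs, Finset.card_union_of_disjoint hdisj, Finset.card_range] at hv
  refine ⟨v, hv, fun q i hq hi => by_contra fun hiS => ?_⟩
  have hai : ¬i < a := fun h => ((hv.fix i h).symm.trans hi.1 ▸ h).not_ge hq
  have hvi : v i = 0 := by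
    rcases lt_or_ge i L with hiL | hiL
    · rw [← hv.map_zero, hvs i hiL 0 (ha.trans_le haL)]
      simp [s, hai, hiS]
    · exact hv.zero i hiL
  exact (ha.trans_le hq).ne (hvi.symm.trans hi.1)

theorem GrahamRothschild.succ.{u} {d : ℕ} (hd : GrahamRothschild.{u} d) :
    GrahamRothschild.{u} (d + 1) := by
  intro a m ha ham κ _ _
  cases nonempty_fintype κ
  classical
  let L := a + Fintype.card κ * (m - a)
  have haL : a ≤ L := Nat.le_add_right ..
  obtain ⟨M, hM⟩ := exists_isRigid_forall_head_comp_eq κ haL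
  obtain ⟨u₀, hu₀, -⟩ := hM fun _ => Classical.arbitrary κ
  obtain ⟨n, hn⟩ := hd.exists_comp_eq_head κ (haL.trans hu₀.le_length)
  refine ⟨n, fun c => ?_⟩
  obtain ⟨t, ht, D, hD⟩ := hn c
  obtain ⟨u, hu, e, he⟩ := hM D
  obtain ⟨x, -, hx⟩ := Finset.exists_le_card_fiber_of_mul_le_card_of_maps_to
    (s := Finset.Ico a L) (t := Finset.univ) (f := e) (n := m - a) (fun _ _ => Finset.mem_univ _)
    Finset.univ_nonempty (by simp [L])
  obtain ⟨S, hS, hScard⟩ := Finset.exists_subset_card_eq hx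
  obtain ⟨v, hv, hvS⟩ := exists_isRigid_firstAt_mem ha haL (hS.trans (Finset.filter_subset ..))
  rw [hScard, Nat.add_sub_cancel' ham] at hv
  refine ⟨v ∘ u ∘ t, hv.comp (hu.comp ht), x, fun f hf => ?_⟩
  obtain ⟨q, hq, hfq⟩ := hf.first a (by omega)
  obtain ⟨p, hp, hvp⟩ := hv.first q hq
  have hfv := hf.comp hv
  calc c (f ∘ v ∘ u ∘ t) = D (head a ((f ∘ v) ∘ u)) := hD _ (hfv.comp hu)
    _ = e p := he _ p hfv.fix (hfq.comp hvp) hp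
    _ = x := (Finset.mem_filter.1 (hS (hvS q p (hf.le_of_firstAt hfq) hvp))).2

theorem grahamRothschild.{u} (d : ℕ) : GrahamRothschild.{u} d := by
  induction d with
  | zero => exact fun a m _ ham κ _ _ => exists_isRigid_forall_comp_eq κ ham
  | succ d ih => exact ih.succ

section Fibers

variable {α β : Type*} [DecidableEq α] [DecidableEq β]

/-- The partition of `s` into the nonempty fibres of `f`. -/
def fiberPartition (s : Finset α) (f : α → β) : Finpartition s :=
  letI : DecidableRel (Setoid.ker f) := fun i j => decEq (f i) (f j)
  .ofSetSetoid (Setoid.ker f) s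

theorem mem_part_fiberPartition {s : Finset α} {f : α → β} {i j : α} :
    j ∈ (fiberPartition s f).part i ↔ i ∈ s ∧ j ∈ s ∧ f i = f j :=
  letI : DecidableRel (Setoid.ker f) := fun i j => decEq (f i) (f j)
  Finpartition.mem_part_ofSetSetoid_iff_rel s

theorem parts_eq_image_part {s : Finset α} (P : Finpartition s) : P.parts = s.image P.part :=
  Finset.coe_injective <| by
    rw [Finset.coe_image]
    exact (P.part_surjOn.image_eq_of_mapsTo fun _ => P.part_mem.2).symm

theorem card_parts_fiberPartition (s : Finset α) (f : α → β) :
    (fiberPartition s f).parts.card = (s.image f).card := by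
  have hparts : (fiberPartition s f).parts = (s.image f).image fun v => {j ∈ s | v = f j} := by
    rw [parts_eq_image_part, Finset.image_image]
    refine Finset.image_congr fun i hi => Finset.ext fun j => ?_
    rw [mem_part_fiberPartition, comp_apply, Finset.mem_filter]
    exact and_iff_right hi
  rw [hparts, Finset.card_image_of_injOn]
  intro v hv v' _ heq
  obtain ⟨i, hi, rfl⟩ := Finset.mem_image.1 hv
  have hiv : i ∈ {j ∈ s | f i = f j} := Finset.mem_filter.2 ⟨hi, rfl⟩
  exact (Finset.mem_filter.1 (Finset.ext_iff.1 heq i |>.1 hiv)).2.symm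

theorem fiberPartition_eq {s : Finset α} {P : Finpartition s} {f : α → β}
    (h : ∀ i ∈ s, ∀ j ∈ s, f i = f j ↔ P.part i = P.part j) : fiberPartition s f = P := by
  refine Finpartition.ext ?_
  rw [parts_eq_image_part, parts_eq_image_part]
  refine Finset.image_congr fun i hi => Finset.ext fun j => ?_
  rw [mem_part_fiberPartition]
  constructor
  · rintro ⟨-, hj, hij⟩
    exact (P.mem_part_iff_part_eq_part hj hi).2 ((h i hi j hj).1 hij).symm
  · intro hj
    have hjs : j ∈ s := P.le (P.part_mem.2 hi) hj
    exact ⟨hi, hjs, (h i hi j hjs).2 ((P.mem_part_iff_part_eq_part hjs hi).1 hj).symm⟩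

end Fibers

section KPartition

variable {a k m n : ℕ} {g t : ℕ → ℕ}

/-- The partition of `{0, …, n - 1}` into the `k` fibres of a rigid surjection. -/
def IsRigid.toKPartition (hg : IsRigid a n k g) : KPartition n k :=
  ⟨fiberPartition (Finset.range n) g, by
    rw [card_parts_fiberPartition, hg.image_range, Finset.card_range]⟩

theorem IsRigid.eq_of_mem_coarsenings (hg : IsRigid a n k g) (ht : IsRigid a n m t)
    (h : hg.toKPartition ∈ ht.toKPartition.coarsenings k) {i i' : ℕ} (hi : i < n) (hi' : i' < n)
    (heq : t i = t i') : g i = g i' := by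
  rw [← Finset.mem_range] at hi hi'
  obtain ⟨b, hb, hsub⟩ := h _ (Finpartition.part_mem _ |>.2 hi)
  have hib : i ∈ b := hsub (mem_part_fiberPartition.2 ⟨hi, hi, rfl⟩)
  have hib' : i' ∈ b := hsub (mem_part_fiberPartition.2 ⟨hi, hi', heq⟩)
  rw [← Finpartition.part_eq_of_mem _ hb hib] at hib'
  exact (mem_part_fiberPartition.1 hib').2.2

theorem KPartition.exists_isRigid (hk : 0 < k) (s : KPartition n k) :
    ∃ g, ∃ hg : IsRigid 1 n k g, hg.toKPartition = s := by
  obtain ⟨P, rfl⟩ := s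
  have hn : 0 < n := by simpa using hk.trans_le P.card_parts_le_card
  obtain ⟨g, hg, hgP⟩ := exists_isRigid_eq_iff P.part hn <| by
    rintro i hi j hj -
    rw [Set.mem_Iio, Nat.lt_one_iff] at hi hj
    rw [hi, hj]
  rw [← parts_eq_image_part] at hg
  exact ⟨g, hg, Subtype.ext (fiberPartition_eq (by simpa using hgP))⟩

end KPartition

theorem mainTheorem11 (r k m : ℕ) (hr : 0 < r) (hk : 0 < k) (hkm : k ≤ m) :
    ∃ n : ℕ, ∀ c : KPartition n k → Fin r,
      ∃ t : KPartition n m, ∃ i : Fin r, ∀ s ∈ t.coarsenings k, c s = i := by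
  classical
  have : Nonempty (Fin r) := ⟨⟨0, hr⟩⟩
  obtain ⟨d, rfl⟩ := Nat.exists_eq_add_of_le (Nat.one_le_of_lt hk)
  obtain ⟨n, hn⟩ := grahamRothschild d 1 m one_pos (hk.trans_le hkm) (Fin r)
  refine ⟨n, fun c => ?_⟩
  obtain ⟨t, ht, x, hx⟩ := hn fun g =>
    if hg : IsRigid 1 n (1 + d) g then c hg.toKPartition else Classical.arbitrary _
  refine ⟨ht.toKPartition, x, fun s hs => ?_⟩
  obtain ⟨g, hg, rfl⟩ := s.exists_isRigid hk
  obtain ⟨f, hf, rfl⟩ := hg.exists_comp_eq ht fun _ hi _ hi' =>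
    hg.eq_of_mem_coarsenings ht hs hi hi'
  simpa only [dif_pos hg] using hx f hf
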